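/- **Setting.** For each $n\ge 1$ let $M=M_n\in\mathbb N$, $\delta^*=\delta^*_n\in\mathbb R$, $\beta^*=\beta^*_n\in\mathbb R^{M}$, let $I^*=\{j:\beta^*_j\ne 0\}$ and $k^*=|I^*|$, and put $$p_0(x)=\frac{1}{1+e^{\delta^*+\beta^{*\prime}x}},\qquad p_1(x)=\frac{e^{\delta^*+\beta^{*\prime}x}}{1+e^{\delta^*+\beta^{*\prime}x}} .$$ Let $q=q_n\ge 0$ be a probability density on $\mathbb R^M$ with respect to a measure $\nu=\nu_n$ (for example Lebesgue measure) with $\int p_0q\,d\nu=\int p_1q\,d\nu=\frac12$, so that $f_0=2p_0q$ and $f_1=2p_1q$ are probability densities. Observe $X^0_1,\dots,X^0_n$ with density $f_0$ and $X^1_1,\dots,X^1_n$ with density $f_1$, all $2n$ observations being independent. Let $\delta_n>0$ be any sequence with $\delta_n\to0$, and, for a constant $L>0$, let $$r=\log n\left(6L\sqrt{\frac{2\log (2(M\vee n))}{n}}+\frac{1}{4(M\vee n)}+4L\sqrt{\frac{2\log(1/\delta_n)}{n}}\right).$$ For all sufficiently large $n$ let $(\widehat\delta,\widehat\beta)\in\mathbb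 R\times\mathbb R^M$ be, almost surely, any minimizer over $(\delta,\beta)$ of $$\frac1{2n}\sum_{i=1}^n\log\bigl(1+e^{\delta+\beta'X_i^1}\bigr)-\frac1{2n}\sum_{i=1}^n(\delta+\beta'X_i^1)+\frac1{2n}\sum_{i=1}^n\log\bigl(1+e^{\delta+\beta'X_i^0}\bigr)+2r\sum_{j=1}^M|\beta_j| .$$ **Assumption 1.** Almost surely all components of all $X_i^0,X_i^1$ are bounded by $L$ in absolute value, and, for some constant $B>0$, $\max_j|\beta_j^*|\le B$ and $|\delta^*|\le B$; $L$ and $B$ do not depend on $n$ or $M$. **Condition H.** Let $X_1,\dots,X_{2n}$ be the pooled sample $X^0_1,\dots,X^0_n,X^1_1,\dots,X^1_n$, with an additional component $X_{0i}=1$ adjoined to each vector; let $\Sigma$ be the $(M+1)\times(M+1)$ matrix with entries $\frac1{2n}\sum_{i=1}^{2n}p_0(X_i)p_1(X_i)X_{ki}X_{ji}$, $0\le j,k\le M$; let $V$ be the diagonal matrix with entries $1$ at the positions of the intercept and of $I^*$, and $0$ elsewhere. There is $0<b\le1$, not depending on $n$, such that $\mathbb P(\Sigma-bV\succeq0)\to1$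 as $n\to\infty$. **Theorem.** Suppose that Assumption 1 and Condition H hold and that $k^*r\to0$. Then for every $w\in(0,1)$, with $c=6/(bw)$, $$\text{(i)}\ \ \mathbb P\bigl(|\widehat\delta-\delta^*|\le c\,r\,k^*\bigr)\to1,\qquad \text{(ii)}\ \ \mathbb P\Bigl(\sum_{j=1}^M|\widehat\beta_j-\beta^*_j|\le c\,r\,k^*\Bigr)\to1\qquad(n\to\infty).$$ -/

import Mathlib

open MeasureTheory ProbabilityTheory Filter Topology

noncomputable section

namespace CaseControl

/-- `p₀(x) = 1 / (1 + exp (δ + β'x))`. -/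
def p0 {M : ℕ} (δ : ℝ) (β : Fin M → ℝ) (x : Fin M → ℝ) : ℝ :=
  1 / (1 + Real.exp (δ + β ⬝ᵥ x))

/-- `p₁(x) = exp (δ + β'x) / (1 + exp (δ + β'x))`. -/
def p1 {M : ℕ} (δ : ℝ) (β : Fin M → ℝ) (x : Fin M → ℝ) : ℝ :=
  Real.exp (δ + β ⬝ᵥ x) / (1 + Real.exp (δ + β ⬝ᵥ x))

/-- `q` is a probability density with respect to the dominating measure `ν`, and `δ`, `β`, `q`
satisfy the constraint that `f₀ = 2 p₀ q` and `f₁ = 2 p₁ q` are probability densities. -/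
structure IsAdmissible {M : ℕ} (ν : Measure (Fin M → ℝ)) (δ : ℝ) (β : Fin M → ℝ)
    (q : (Fin M → ℝ) → ℝ) : Prop where
  measurable : Measurable q
  nonneg : ∀ x, 0 ≤ q x
  integral_eq_one : ∫ x, q x ∂ν = 1
  constraint_zero : ∫ x, p0 δ β x * q x ∂ν = 1 / 2
  constraint_one : ∫ x, p1 δ β x * q x ∂ν = 1 / 2

/-- The law of the controls, with density `f₀ = 2 p₀ q`. -/
def controlLaw {M : ℕ} (ν : Measure (Fin M → ℝ)) (δ : ℝ) (β : Fin M → ℝ)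
    (q : (Fin M → ℝ) → ℝ) : Measure (Fin M → ℝ) :=
  ν.withDensity fun x => ENNReal.ofReal (2 * p0 δ β x * q x)

/-- The law of the cases, with density `f₁ = 2 p₁ q`. -/
def caseLaw {M : ℕ} (ν : Measure (Fin M → ℝ)) (δ : ℝ) (β : Fin M → ℝ)
    (q : (Fin M → ℝ) → ℝ) : Measure (Fin M → ℝ) :=
  ν.withDensity fun x => ENNReal.ofReal (2 * p1 δ β x * q x)

/-- The retrospective sampling scheme: `n` controls with density `f₀` and `n` cases with
density `f₁`, all `2n` observations being independent. -/
structure IsRetrospectiveSample {M n : ℕ} {Ω : Type*} [MeasurableSpace Ω] (P : Measure Ω)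
    (ν : Measure (Fin M → ℝ)) (δ : ℝ) (β : Fin M → ℝ) (q : (Fin M → ℝ) → ℝ)
    (X0 X1 : Fin n → Ω → (Fin M → ℝ)) : Prop where
  measurable_control : ∀ i, Measurable (X0 i)
  measurable_case : ∀ i, Measurable (X1 i)
  law_control : ∀ i, P.map (X0 i) = controlLaw ν δ β q
  law_case : ∀ i, P.map (X1 i) = caseLaw ν δ β q
  indep : iIndepFun (Sum.elim X0 X1) P

/-- The set `I*` of the indices of the non-zero components of `β`. -/
def activeSet {M : ℕ} (β : Fin M → ℝ) : Finset (Fin M) :=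
  Finset.univ.filter fun j => β j ≠ 0

/-- The rescaled negative prospective log-likelihood `-(1/2n) log ∏ᵢ p₀(xᵢ⁰) p₁(xᵢ¹)`, written out
as a sum, for controls `x0` and cases `x1`. -/
def prospectiveLoss {M n : ℕ} (x0 x1 : Fin n → Fin M → ℝ) (δ : ℝ) (β : Fin M → ℝ) : ℝ :=
  1 / (2 * (n : ℝ)) * ∑ i, Real.log (1 + Real.exp (δ + β ⬝ᵥ x1 i))
    - 1 / (2 * (n : ℝ)) * ∑ i, (δ + β ⬝ᵥ x1 i)
    + 1 / (2 * (n : ℝ)) * ∑ i, Real.log (1 + Real.exp (δ + β ⬝ᵥ x0 i))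

/-- The loss with the penalty `lam * ∑ⱼ |βⱼ|`; the intercept is not penalized. -/
def penalizedLoss {M n : ℕ} (lam : ℝ) (x0 x1 : Fin n → Fin M → ℝ) (δ : ℝ) (β : Fin M → ℝ) : ℝ :=
  prospectiveLoss x0 x1 δ β + lam * ∑ j, |β j|

/-- `(δh, βh)` minimizes the penalized loss over `ℝ × ℝ^M`. -/
def IsPenalizedEstimate {M n : ℕ} (lam : ℝ) (x0 x1 : Fin n → Fin M → ℝ)
    (δh : ℝ) (βh : Fin M → ℝ) : Prop :=
  ∀ (δ : ℝ) (β : Fin M → ℝ), penalizedLoss lam x0 x1 δh βh ≤ penalizedLoss lam x0 x1 δ β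

/-- The tuning sequence `r`, with `d` the value of the sequence `δ_n`. -/
def tuning (L : ℝ) (M n : ℕ) (d : ℝ) : ℝ :=
  Real.log n *
    (6 * L * √(2 * Real.log (2 * ((max M n : ℕ) : ℝ)) / n)
      + 1 / (4 * ((max M n : ℕ) : ℝ))
      + 4 * L * √(2 * Real.log (1 / d) / n))

/-- The vector of `ℝ^(M+1)` with first component `1` followed by `x`. -/
def withIntercept {M : ℕ} (x : Fin M → ℝ) : Fin (M + 1) → ℝ :=
  Fin.cons 1 x

/-- The sample Hessian `Σ`, over the `2n` observations `x0`, `x1`. -/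
def sampleHessian {M n : ℕ} (δ : ℝ) (β : Fin M → ℝ) (x0 x1 : Fin n → Fin M → ℝ) :
    Matrix (Fin (M + 1)) (Fin (M + 1)) ℝ :=
  Matrix.of fun k j => 1 / (2 * (n : ℝ)) * ∑ i : Fin n ⊕ Fin n,
    p0 δ β (Sum.elim x0 x1 i) * p1 δ β (Sum.elim x0 x1 i)
      * withIntercept (Sum.elim x0 x1 i) k * withIntercept (Sum.elim x0 x1 i) j

/-- The matrix `V`: the identity on the intercept and on `I*`, zero elsewhere. -/
def selector {M : ℕ} (β : Fin M → ℝ) : Matrix (Fin (M + 1)) (Fin (M + 1)) ℝ :=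
  Matrix.diagonal (Fin.cons 1 fun j => if j ∈ activeSet β then 1 else 0)

end CaseControl

end

/-! Although sampling is retrospective, the prospective log-likelihood has a centred gradient at the
truth: a control contributes `p1 * x` under the density `2 * p0 * q`, a case `-p0 * x` under `2 * p1
* q`, and these means cancel in pairs (`sum_integral_scoreTerm`). Hoeffding's inequality and a union
bound over the `M + 1` coordinates then put every score component below `r / 10`, outside an event
of probability at most `1 / n` (`measure_exists_score_ge_le`).

The rest is deterministic. If no linear predictor moves by more than `1 / 5`, the loss exceeds its
tangent at the truth by `2 / 5` of the Hessian form (`prospectiveLoss_add_ge`), and Condition H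
bounds that form below by `b` times the squared errors of the intercept and on `I*`. Minimality of
the penalized loss gives a quadratic inequality whose only adverse terms are `4 * r * ∑ |Δ j|` over
`I*` and the intercept score. Completing squares absorbs both into the curvature
(`error_bound_of_quadratic`). Convexity removes the locality restriction: an estimate too far away
could be pulled back along the segment to the truth until it lies on the boundary of the region,
where the bound just obtained contradicts `k* r → 0` (`IsPenalizedEstimate.error_bound`).

The resulting constant is `6 / b`, and `w < 1` only enlarges it. -/

namespace CaseControl

/-! ### Local curvature of the logistic loss -/

/-- The function `u ↦ log (1 + exp u)`. -/
noncomputable def softplus (u : ℝ) : ℝ := Real.log (1 + Real.exp u)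

/-- The logistic function `u ↦ exp u / (1 + exp u)`. -/
noncomputable def logistic (u : ℝ) : ℝ := Real.exp u / (1 + Real.exp u)

lemma one_add_exp_pos (u : ℝ) : 0 < 1 + Real.exp u := by positivity

lemma hasDerivAt_softplus (u : ℝ) : HasDerivAt softplus (logistic u) u :=
  ((Real.hasDerivAt_exp u).const_add 1).log (one_add_exp_pos u).ne'

lemma logistic_neg (u : ℝ) : logistic (-u) = 1 - logistic u := by
  have := Real.exp_pos u
  unfold logistic
  rw [Real.exp_neg]
  field_simp
  ring

lemma softplus_neg (u : ℝ) : softplus (-u) = softplus u - u := by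
  have h := Real.exp_pos u
  unfold softplus
  have : 1 + Real.exp (-u) = (1 + Real.exp u) / Real.exp u := by
    rw [Real.exp_neg]; field_simp; ring
  rw [this, Real.log_div (one_add_exp_pos u).ne' h.ne', Real.log_exp]

lemma logistic_mono : Monotone logistic := by
  intro u v huv
  have := Real.exp_le_exp.mpr huv
  unfold logistic
  rw [div_le_div_iff₀ (one_add_exp_pos u) (one_add_exp_pos v)]
  nlinarith

lemma convexOn_softplus : ConvexOn ℝ Set.univ softplus := by
  refine MonotoneOn.convexOn_of_deriv convex_univ
    (fun u _ => (hasDerivAt_softplus u).continuousAt.continuousWithinAt)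
    (fun u _ => (hasDerivAt_softplus u).differentiableAt.differentiableWithinAt) ?_
  have : deriv softplus = logistic := funext fun u => (hasDerivAt_softplus u).deriv
  rw [this]
  exact logistic_mono.monotoneOn _

/-- After clearing denominators and using `exp v ≥ 1 + v`, the coefficient of `exp u` reduces to `v
/ 5 * (1 - 4 * v)`, which is nonnegative up to `v = 1 / 4`. Hence a step of `1 / 5` loses at most a
fifth of the slope at `u`, uniformly in `u`. -/
lemma logistic_add_ge (u : ℝ) {v : ℝ} (hv : 0 ≤ v) (hv' : v ≤ 1 / 5) :
    logistic u + 4 / 5 * (logistic u * (1 - logistic u)) * v ≤ logistic (u + v) := by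
  have hE := Real.exp_pos u
  have hw := Real.add_one_le_exp v
  unfold logistic
  rw [Real.exp_add]
  set E := Real.exp u
  set W := Real.exp v
  have hW : 0 < W := Real.exp_pos v
  have key : E * W / (1 + E * W) - (E / (1 + E) + 4 / 5 * (E / (1 + E) * (1 - E / (1 + E))) * v)
      = E * ((W - 1) * (1 + E) - 4 / 5 * v * (1 + E * W)) / ((1 + E) ^ 2 * (1 + E * W)) := by
    field_simp
    ring
  have h : 0 ≤ (W - 1) * (1 + E) - 4 / 5 * v * (1 + E * W) := by
    nlinarith [mul_nonneg hE.le (sub_nonneg.mpr hw), mul_nonneg hv (sub_nonneg.mpr hv'),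
      mul_nonneg (mul_nonneg hE.le (sub_nonneg.mpr hw)) hv,
      mul_nonneg (mul_nonneg hE.le (sub_nonneg.mpr hw)) (sub_nonneg.mpr hv'),
      mul_nonneg hE.le (mul_nonneg hv (sub_nonneg.mpr hv')), mul_nonneg hE.le hv]
  have : 0 ≤ E * ((W - 1) * (1 + E) - 4 / 5 * v * (1 + E * W)) / ((1 + E) ^ 2 * (1 + E * W)) := by
    positivity
  linarith

lemma softplus_add_ge_of_nonneg (u : ℝ) {v : ℝ} (hv : 0 ≤ v) (hv' : v ≤ 1 / 5) :
    softplus u + logistic u * v + 2 / 5 * (logistic u * (1 - logistic u)) * v ^ 2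
      ≤ softplus (u + v) := by
  let G : ℝ → ℝ := fun v => softplus (u + v) - logistic u * v
    - 2 / 5 * (logistic u * (1 - logistic u)) * v ^ 2
  have hG : ∀ x, HasDerivAt G (logistic (u + x) - logistic u
      - 4 / 5 * (logistic u * (1 - logistic u)) * x) x := by
    intro x
    have h1 : HasDerivAt (fun y => softplus (u + y)) (logistic (u + x)) x :=
      (hasDerivAt_softplus (u + x)).comp_const_add u x
    have h2 := (hasDerivAt_id x).const_mul (logistic u)
    have h3 := (hasDerivAt_pow 2 x).const_mul (2 / 5 * (logistic u * (1 - logistic u)))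
    refine ((h1.sub h2).sub h3).congr_deriv ?_
    norm_num
    ring
  have hmono : MonotoneOn G (Set.Icc 0 (1 / 5)) := by
    refine monotoneOn_of_deriv_nonneg (convex_Icc _ _)
      (fun x _ => (hG x).continuousAt.continuousWithinAt)
      (fun x _ => (hG x).differentiableAt.differentiableWithinAt) ?_
    intro x hx
    rw [interior_Icc] at hx
    rw [(hG x).deriv]
    have := logistic_add_ge u hx.1.le hx.2.le
    linarith
  have h := hmono (Set.left_mem_Icc.mpr (by norm_num)) ⟨hv, hv'⟩ hv
  simp only [G, add_zero, mul_zero, sub_zero, ne_eq, OfNat.ofNat_ne_zero, not_false_eq_true,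
    zero_pow] at h
  linarith

/-- A quadratic lower bound for `log (1 + exp)` near a point, relative to its own curvature. -/
lemma softplus_add_ge (u : ℝ) {v : ℝ} (hv : |v| ≤ 1 / 5) :
    softplus u + logistic u * v + 2 / 5 * (logistic u * (1 - logistic u)) * v ^ 2
      ≤ softplus (u + v) := by
  obtain ⟨h1, h2⟩ := abs_le.mp hv
  rcases le_total 0 v with h | h
  · exact softplus_add_ge_of_nonneg u h h2
  -- Negative increments follow by reflection: `u ↦ -u` changes the loss by a linear term and leaves
  -- the curvature unchanged.
  · have := softplus_add_ge_of_nonneg (-u) (v := -v) (by linarith) (by linarith)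
    rw [← neg_add, softplus_neg, softplus_neg, logistic_neg] at this
    linarith

/-! ### Gradient, Hessian and convexity of the prospective loss -/

lemma p1_eq_logistic {M : ℕ} (δ : ℝ) (β x : Fin M → ℝ) : p1 δ β x = logistic (δ + β ⬝ᵥ x) := rfl

lemma p0_eq_one_sub_logistic {M : ℕ} (δ : ℝ) (β x : Fin M → ℝ) :
    p0 δ β x = 1 - logistic (δ + β ⬝ᵥ x) := by
  have := one_add_exp_pos (δ + β ⬝ᵥ x)
  unfold p0 logistic
  field_simp
  ring

lemma p0_add_p1 {M : ℕ} (δ : ℝ) (β x : Fin M → ℝ) : p0 δ β x + p1 δ β x = 1 := by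
  rw [p0_eq_one_sub_logistic, p1_eq_logistic]; ring

lemma p0_nonneg {M : ℕ} (δ : ℝ) (β x : Fin M → ℝ) : 0 ≤ p0 δ β x := by
  unfold p0; positivity

lemma p1_nonneg {M : ℕ} (δ : ℝ) (β x : Fin M → ℝ) : 0 ≤ p1 δ β x := by
  unfold p1; positivity

/-- The residual of an observation: `p₁` for a control and `-p₀` for a case. -/
noncomputable def residual {M n : ℕ} (δ : ℝ) (β : Fin M → ℝ) : Fin n ⊕ Fin n → (Fin M → ℝ) → ℝ :=
  Sum.elim (fun _ x => p1 δ β x) (fun _ x => -p0 δ β x)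

/-- The gradient of the prospective loss in `(δ, β)`. -/
noncomputable def score {M n : ℕ} (δ : ℝ) (β : Fin M → ℝ) (x0 x1 : Fin n → Fin M → ℝ) :
    Fin (M + 1) → ℝ :=
  fun k => 1 / (2 * (n : ℝ)) * ∑ i : Fin n ⊕ Fin n,
    residual δ β i (Sum.elim x0 x1 i) * withIntercept (Sum.elim x0 x1 i) k

/-- The contribution of one observation to the loss, as a function of the linear predictor. -/
noncomputable def pointLoss {n : ℕ} : Fin n ⊕ Fin n → ℝ → ℝ :=
  Sum.elim (fun _ u => softplus u) (fun _ u => softplus u - u)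

lemma prospectiveLoss_eq_sum {M n : ℕ} (x0 x1 : Fin n → Fin M → ℝ) (δ : ℝ) (β : Fin M → ℝ) :
    prospectiveLoss x0 x1 δ β = 1 / (2 * (n : ℝ)) * ∑ i : Fin n ⊕ Fin n,
      pointLoss i (δ + β ⬝ᵥ Sum.elim x0 x1 i) := by
  simp only [prospectiveLoss, Fintype.sum_sum_type, pointLoss, Sum.elim_inl, Sum.elim_inr,
    Finset.sum_sub_distrib, softplus]
  ring

lemma convexOn_pointLoss {n : ℕ} (i : Fin n ⊕ Fin n) : ConvexOn ℝ Set.univ (pointLoss i) := by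
  cases i with
  | inl i => exact convexOn_softplus
  | inr i => exact convexOn_softplus.sub (concaveOn_id convex_univ)

lemma pointLoss_add_ge {M n : ℕ} (i : Fin n ⊕ Fin n) (δ : ℝ) (β x : Fin M → ℝ) {v : ℝ}
    (hv : |v| ≤ 1 / 5) :
    pointLoss i (δ + β ⬝ᵥ x) + residual δ β i x * v + 2 / 5 * (p0 δ β x * p1 δ β x) * v ^ 2
      ≤ pointLoss i (δ + β ⬝ᵥ x + v) := by
  have := softplus_add_ge (δ + β ⬝ᵥ x) hv
  cases i <;>
  · simp only [pointLoss, residual, Sum.elim_inl, Sum.elim_inr, p1_eq_logistic,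
      p0_eq_one_sub_logistic]
    linarith

lemma withIntercept_dotProduct {M : ℕ} (x : Fin M → ℝ) (a : ℝ) (Δ : Fin M → ℝ) :
    withIntercept x ⬝ᵥ (Fin.cons a Δ : Fin (M + 1) → ℝ) = a + Δ ⬝ᵥ x := by
  simp [withIntercept, dotProduct, Fin.sum_univ_succ, mul_comm]

lemma score_dotProduct {M n : ℕ} (δ : ℝ) (β : Fin M → ℝ) (x0 x1 : Fin n → Fin M → ℝ)
    (v : Fin (M + 1) → ℝ) :
    score δ β x0 x1 ⬝ᵥ v = 1 / (2 * (n : ℝ)) * ∑ i : Fin n ⊕ Fin n,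
      residual δ β i (Sum.elim x0 x1 i) * (withIntercept (Sum.elim x0 x1 i) ⬝ᵥ v) := by
  simp only [score, dotProduct, Finset.mul_sum, Finset.sum_mul]
  rw [Finset.sum_comm]
  exact Finset.sum_congr rfl fun i _ => Finset.sum_congr rfl fun k _ => by ring

lemma sampleHessian_quadraticForm {M n : ℕ} (δ : ℝ) (β : Fin M → ℝ) (x0 x1 : Fin n → Fin M → ℝ)
    (v : Fin (M + 1) → ℝ) :
    v ⬝ᵥ (sampleHessian δ β x0 x1).mulVec v = 1 / (2 * (n : ℝ)) * ∑ i : Fin n ⊕ Fin n,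
      p0 δ β (Sum.elim x0 x1 i) * p1 δ β (Sum.elim x0 x1 i)
        * (withIntercept (Sum.elim x0 x1 i) ⬝ᵥ v) ^ 2 := by
  simp only [sampleHessian, dotProduct, Matrix.mulVec, Matrix.of_apply, Finset.mul_sum,
    Finset.sum_mul, sq]
  rw [Finset.sum_comm' (t' := Finset.univ) (s' := fun _ => Finset.univ) (by simp)]
  rw [Finset.sum_congr rfl fun (j : Fin (M + 1)) _ => Finset.sum_comm, Finset.sum_comm]
  refine Finset.sum_congr rfl fun i _ => Finset.sum_congr rfl fun k _ =>
    Finset.sum_congr rfl fun j _ => by ring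

/-- The one-dimensional bound is summed over observations. Its curvature is taken at the base point,
so the quadratic terms add up to the sample Hessian at the truth, the matrix governed by Condition
H. -/
lemma prospectiveLoss_add_ge {M n : ℕ} (x0 x1 : Fin n → Fin M → ℝ) (δ a : ℝ) (β Δ : Fin M → ℝ)
    (h : ∀ i, |a + Δ ⬝ᵥ Sum.elim x0 x1 i| ≤ 1 / 5) :
    prospectiveLoss x0 x1 δ β + score δ β x0 x1 ⬝ᵥ (Fin.cons a Δ : Fin (M + 1) → ℝ)
      + 2 / 5 * ((Fin.cons a Δ : Fin (M + 1) → ℝ) ⬝ᵥ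
        (sampleHessian δ β x0 x1).mulVec (Fin.cons a Δ : Fin (M + 1) → ℝ))
      ≤ prospectiveLoss x0 x1 (δ + a) (β + Δ) := by
  rw [prospectiveLoss_eq_sum, prospectiveLoss_eq_sum, score_dotProduct,
    sampleHessian_quadraticForm]
  have key : ∑ i : Fin n ⊕ Fin n, (pointLoss i (δ + β ⬝ᵥ Sum.elim x0 x1 i)
      + residual δ β i (Sum.elim x0 x1 i) * (a + Δ ⬝ᵥ Sum.elim x0 x1 i)
      + 2 / 5 * (p0 δ β (Sum.elim x0 x1 i) * p1 δ β (Sum.elim x0 x1 i))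
        * (a + Δ ⬝ᵥ Sum.elim x0 x1 i) ^ 2)
      ≤ ∑ i : Fin n ⊕ Fin n, pointLoss i (δ + a + (β + Δ) ⬝ᵥ Sum.elim x0 x1 i) := by
    refine Finset.sum_le_sum fun i _ => ?_
    refine (pointLoss_add_ge i δ β _ (h i)).trans_eq ?_
    rw [add_dotProduct]
    congr 1
    ring
  have := mul_le_mul_of_nonneg_left key (by positivity : 0 ≤ 1 / (2 * (n : ℝ)))
  refine le_trans (le_of_eq ?_) this
  simp only [withIntercept_dotProduct, Finset.sum_add_distrib, mul_add, mul_assoc,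
    ← Finset.mul_sum]
  ring

lemma penalizedLoss_convex {M n : ℕ} {lam : ℝ} (hlam : 0 ≤ lam) (x0 x1 : Fin n → Fin M → ℝ)
    (δ a : ℝ) (β Δ : Fin M → ℝ) {t : ℝ} (ht : 0 ≤ t) (ht1 : t ≤ 1) :
    penalizedLoss lam x0 x1 (δ + t * a) (β + t • Δ)
      ≤ (1 - t) * penalizedLoss lam x0 x1 δ β + t * penalizedLoss lam x0 x1 (δ + a) (β + Δ) := by
  have h1 : ∑ i : Fin n ⊕ Fin n, pointLoss i (δ + t * a + (β + t • Δ) ⬝ᵥ Sum.elim x0 x1 i)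
      ≤ ∑ i : Fin n ⊕ Fin n, ((1 - t) * pointLoss i (δ + β ⬝ᵥ Sum.elim x0 x1 i)
        + t * pointLoss i (δ + a + (β + Δ) ⬝ᵥ Sum.elim x0 x1 i)) := by
    refine Finset.sum_le_sum fun i _ => ?_
    have := (convexOn_pointLoss i).2 (Set.mem_univ (δ + β ⬝ᵥ Sum.elim x0 x1 i))
      (Set.mem_univ (δ + a + (β + Δ) ⬝ᵥ Sum.elim x0 x1 i)) (sub_nonneg.mpr ht1) ht (by ring)
    refine le_trans (le_of_eq ?_) this
    congr 1
    simp only [add_dotProduct, smul_dotProduct, smul_eq_mul]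
    ring
  have h2 : ∑ j, |(β + t • Δ) j| ≤ ∑ j, ((1 - t) * |β j| + t * |(β + Δ) j|) := by
    refine Finset.sum_le_sum fun j _ => ?_
    calc |(β + t • Δ) j| = |(1 - t) * β j + t * (β + Δ) j| := by
          congr 1
          simp only [Pi.add_apply, Pi.smul_apply, smul_eq_mul]
          ring
      _ ≤ _ := (abs_add_le _ _).trans_eq (by
          rw [abs_mul, abs_mul, abs_of_nonneg ht, abs_of_nonneg (sub_nonneg.mpr ht1)])
  have h1' := mul_le_mul_of_nonneg_left h1 (by positivity : 0 ≤ 1 / (2 * (n : ℝ)))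
  have h2' := mul_le_mul_of_nonneg_left h2 hlam
  rw [Finset.sum_add_distrib, ← Finset.mul_sum, ← Finset.mul_sum] at h1' h2'
  simp only [penalizedLoss, prospectiveLoss_eq_sum]
  linarith

/-! ### Deterministic error bound -/

/-- The increment of the penalty is controlled by the increment on the support. -/
lemma penalty_add_ge {M : ℕ} (β Δ : Fin M → ℝ) :
    ∑ j, |β j| + ∑ j, |Δ j| - 2 * ∑ j ∈ activeSet β, |Δ j| ≤ ∑ j, |(β + Δ) j| := by
  have h : ∀ j, |β j| + |Δ j| - 2 * (if β j ≠ 0 then |Δ j| else 0) ≤ |(β + Δ) j| := by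
    intro j
    by_cases hj : β j = 0
    · simp [hj]
    · have := abs_add_le (β j + Δ j) (-Δ j)
      rw [abs_neg, add_neg_cancel_right] at this
      simp only [ne_eq, hj, not_false_eq_true, if_true, Pi.add_apply]
      linarith
  have := Finset.sum_le_sum fun j (_ : j ∈ Finset.univ) => h j
  rwa [Finset.sum_sub_distrib, Finset.sum_add_distrib, ← Finset.mul_sum, ← Finset.sum_filter]
    at this

lemma selector_quadraticForm {M : ℕ} (β : Fin M → ℝ) (a : ℝ) (Δ : Fin M → ℝ) :
    (Fin.cons a Δ : Fin (M + 1) → ℝ) ⬝ᵥ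
      (selector β).mulVec (Fin.cons a Δ : Fin (M + 1) → ℝ)
      = a ^ 2 + ∑ j ∈ activeSet β, Δ j ^ 2 := by
  simp only [selector, Matrix.mulVec_diagonal, dotProduct, Fin.sum_univ_succ, Fin.cons_zero,
    Fin.cons_succ]
  congr 1
  · ring
  · rw [← Finset.sum_filter_add_sum_filter_not Finset.univ (· ∈ activeSet β)]
    simp only [Finset.filter_univ_mem, ite_mul, one_mul, zero_mul, mul_ite, mul_zero]
    rw [Finset.sum_congr rfl fun j hj => if_pos hj,
      Finset.sum_eq_zero (s := Finset.univ.filter (· ∉ activeSet β))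
        fun j hj => if_neg (Finset.mem_filter.mp hj).2, add_zero]
    exact Finset.sum_congr rfl fun j _ => by ring

lemma selector_le_sampleHessian {M n : ℕ} {b δ : ℝ} {β : Fin M → ℝ} {x0 x1 : Fin n → Fin M → ℝ}
    (h : (sampleHessian δ β x0 x1 - b • selector β).PosSemidef) (a : ℝ) (Δ : Fin M → ℝ) :
    b * (a ^ 2 + ∑ j ∈ activeSet β, Δ j ^ 2) ≤ (Fin.cons a Δ : Fin (M + 1) → ℝ) ⬝ᵥ
      (sampleHessian δ β x0 x1).mulVec (Fin.cons a Δ : Fin (M + 1) → ℝ) := by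
  have := h.dotProduct_mulVec_nonneg (Fin.cons a Δ : Fin (M + 1) → ℝ)
  rw [star_trivial, Matrix.sub_mulVec, dotProduct_sub, Matrix.smul_mulVec, dotProduct_smul,
    selector_quadraticForm, smul_eq_mul] at this
  linarith

/-- The arithmetic of the error bound: a quadratic inequality in the errors `a` of the intercept
and `Δ` of the coefficients bounds both at the scale `r k / b`. -/
lemma error_bound_of_quadratic {ι : Type*} {I : Finset ι} {Δ : ι → ℝ} {a b r g S : ℝ}
    (hb : 0 < b) (hr : 0 < r) (hS : 0 ≤ S)
    (hg : g ^ 2 ≤ r ^ 2 / 100 * I.card)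
    (h : 19 / 10 * r * S + 2 / 5 * (b * (a ^ 2 + ∑ j ∈ I, Δ j ^ 2))
      ≤ 4 * r * ∑ j ∈ I, |Δ j| - g * a) :
    |a| ≤ 6 / b * r * I.card ∧ S ≤ 6 / b * r * I.card := by
  have hI : 4 * r * ∑ j ∈ I, |Δ j|
      ≤ 2 / 5 * b * ∑ j ∈ I, Δ j ^ 2 + 10 * r ^ 2 / b * I.card := by
    -- The square uses up the whole curvature `2 / 5 * b` in each active coordinate, leaving `10 * r
    -- ^ 2 / b` per coordinate.
    have : ∀ j ∈ I, 4 * r * |Δ j| ≤ 2 / 5 * b * Δ j ^ 2 + 10 * r ^ 2 / b := by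
      intro j _
      have h0 : 2 / 5 * b * Δ j ^ 2 + 10 * r ^ 2 / b - 4 * r * |Δ j|
          = 2 / 5 * (b * |Δ j| - 5 * r) ^ 2 / b := by
        rw [← sq_abs (Δ j)]
        field_simp
        ring
      have : 0 ≤ 2 / 5 * (b * |Δ j| - 5 * r) ^ 2 / b := by positivity
      linarith
    refine (Finset.mul_sum _ _ _).trans_le ((Finset.sum_le_sum this).trans_eq ?_)
    rw [Finset.sum_add_distrib, ← Finset.mul_sum, Finset.sum_const, nsmul_eq_mul]
    ring
  -- Integrality of the cardinality: the bound on `a ^ 2` is linear in `k`, while the target for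
  -- `|a|` is linear too, so `k ≤ k ^ 2` is needed.
  have hk : (I.card : ℝ) ≤ (I.card : ℝ) ^ 2 := by
    exact_mod_cast Nat.le_self_pow two_ne_zero I.card
  set k := (I.card : ℝ)
  have hk0 : 0 ≤ k := Nat.cast_nonneg _
  have hab : 9 / 25 * b * a ^ 2 + 19 / 10 * r * S ≤ (10 + 1 / 16) * r ^ 2 / b * k := by
    -- Only `1 / 25` of the intercept curvature `2 / 5` is spent on the score, which leaves `9 /
    -- 25`.
    have h1 : -(g * a) ≤ 1 / 25 * b * a ^ 2 + 25 / 4 * g ^ 2 / b := by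
      have h0 : 1 / 25 * b * a ^ 2 + 25 / 4 * g ^ 2 / b + g * a
          = (2 / 5 * b * a + 5 * g) ^ 2 / (4 * b) := by
        field_simp
        ring
      have : 0 ≤ (2 / 5 * b * a + 5 * g) ^ 2 / (4 * b) := by positivity
      linarith
    have h2 : 25 / 4 * g ^ 2 / b ≤ 25 / 4 * (r ^ 2 / 100 * k) / b := by gcongr
    have h3 : (10 + 1 / 16) * r ^ 2 / b * k
        = 10 * r ^ 2 / b * k + 25 / 4 * (r ^ 2 / 100 * k) / b := by ring
    rw [h3]
    linarith
  constructor
  · refine abs_le_of_sq_le_sq ?_ (by positivity)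
    have h1 : 9 / 25 * b * a ^ 2 ≤ (10 + 1 / 16) * r ^ 2 / b * k ^ 2 := by
      have h2 : (10 + 1 / 16) * r ^ 2 / b * k ≤ (10 + 1 / 16) * r ^ 2 / b * k ^ 2 := by gcongr
      have : 0 ≤ 19 / 10 * r * S := by positivity
      linarith
    have h2 : 9 / 25 * b * (6 / b * r * k) ^ 2 = (9 / 25 * 36) * r ^ 2 / b * k ^ 2 := by
      field_simp
      ring
    have h3 : (10 + 1 / 16) * r ^ 2 / b * k ^ 2 ≤ (9 / 25 * 36) * r ^ 2 / b * k ^ 2 := by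
      gcongr
      norm_num
    refine le_of_mul_le_mul_left (a := 9 / 25 * b) ?_ (by positivity)
    linarith
  · have h1 : 19 / 10 * r * S ≤ (10 + 1 / 16) * r ^ 2 / b * k := by
      have : 0 ≤ 9 / 25 * b * a ^ 2 := by positivity
      linarith
    have h2 : 19 / 10 * r * (6 / b * r * k) = (57 / 5) * r ^ 2 / b * k := by ring
    have h3 : (10 + 1 / 16) * r ^ 2 / b * k ≤ (57 / 5) * r ^ 2 / b * k := by
      gcongr
      norm_num
    refine le_of_mul_le_mul_left (a := 19 / 10 * r) ?_ (by positivity)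
    linarith

lemma abs_dotProduct_le {M : ℕ} {L : ℝ} (Δ x : Fin M → ℝ) (hx : ∀ j, |x j| ≤ L) :
    |Δ ⬝ᵥ x| ≤ L * ∑ j, |Δ j| := by
  refine (Finset.abs_sum_le_sum_abs _ _).trans ?_
  rw [Finset.mul_sum]
  refine Finset.sum_le_sum fun j _ => ?_
  rw [abs_mul, mul_comm]
  exact mul_le_mul_of_nonneg_right (hx j) (abs_nonneg _)

/-- The error bound for increments that stay in the region where the curvature is controlled. -/
lemma error_bound_of_small {M n : ℕ} {x0 x1 : Fin n → Fin M → ℝ} {b r δ a : ℝ}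
    {β Δ : Fin M → ℝ} (hb : 0 < b) (hr : 0 < r)
    (hH : (sampleHessian δ β x0 x1 - b • selector β).PosSemidef)
    (hs : ∀ j, |score δ β x0 x1 (Fin.succ j)| ≤ r / 10)
    (hs0 : score δ β x0 x1 0 ^ 2 ≤ r ^ 2 / 100 * (activeSet β).card)
    (hsmall : ∀ i, |a + Δ ⬝ᵥ Sum.elim x0 x1 i| ≤ 1 / 5)
    (hle : penalizedLoss (2 * r) x0 x1 (δ + a) (β + Δ) ≤ penalizedLoss (2 * r) x0 x1 δ β) :
    |a| ≤ 6 / b * r * (activeSet β).card ∧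
      ∑ j, |Δ j| ≤ 6 / b * r * (activeSet β).card := by
  refine error_bound_of_quadratic (Δ := Δ) (g := score δ β x0 x1 0) hb hr (by positivity) hs0 ?_
  have h1 := prospectiveLoss_add_ge x0 x1 δ a β Δ hsmall
  have h2 := selector_le_sampleHessian hH a Δ
  have h3 := mul_le_mul_of_nonneg_left (penalty_add_ge β Δ) (by positivity : 0 ≤ 2 * r)
  have h4 : score δ β x0 x1 ⬝ᵥ (Fin.cons a Δ : Fin (M + 1) → ℝ)
      = score δ β x0 x1 0 * a + Δ ⬝ᵥ fun j => score δ β x0 x1 (Fin.succ j) := by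
    simp [dotProduct, Fin.sum_univ_succ, mul_comm]
  have h5 := neg_le_of_abs_le (abs_dotProduct_le Δ _ hs)
  unfold penalizedLoss at hle
  -- The coefficient `19 / 10 * r` is the penalty level `2 * r` less the score bound `r / 10`.
  linarith

/-- The deterministic error bound for the `ℓ₁`-penalized estimate. -/
theorem IsPenalizedEstimate.error_bound {M n : ℕ} {x0 x1 : Fin n → Fin M → ℝ} {b r L δ δh : ℝ}
    {β βh : Fin M → ℝ} (hest : IsPenalizedEstimate (2 * r) x0 x1 δh βh)
    (hb : 0 < b) (hr : 0 < r) (hL : 0 ≤ L)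
    (hx0 : ∀ i j, |x0 i j| ≤ L) (hx1 : ∀ i j, |x1 i j| ≤ L)
    (hH : (sampleHessian δ β x0 x1 - b • selector β).PosSemidef)
    (hs : ∀ j, |score δ β x0 x1 (Fin.succ j)| ≤ r / 10)
    (hs0 : score δ β x0 x1 0 ^ 2 ≤ r ^ 2 / 100 * (activeSet β).card)
    (hsmall : (1 + L) * (6 / b * r * (activeSet β).card) ≤ 1 / 10) :
    |δh - δ| ≤ 6 / b * r * (activeSet β).card ∧
      ∑ j, |βh j - β j| ≤ 6 / b * r * (activeSet β).card := by
  set a := δh - δ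
  set Δ := βh - β
  have hx : ∀ i j, |Sum.elim x0 x1 i j| ≤ L := by
    rintro (i | i) j
    exacts [hx0 i j, hx1 i j]
  have hδ : δ + a = δh := by simp [a]
  have hβ : β + Δ = βh := by simp [Δ]
  -- `N` dominates the change of the linear predictor at every observation.
  let N := |a| + L * ∑ j, |Δ j|
  have hN : 0 ≤ N := by positivity
  have key : ∀ t : ℝ, 0 ≤ t → t ≤ 1 → t * N ≤ 1 / 5 →
      t * |a| ≤ 6 / b * r * (activeSet β).card ∧
        t * ∑ j, |Δ j| ≤ 6 / b * r * (activeSet β).card := by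
    intro t ht ht1 htN
    have hsum : ∑ j, |(t • Δ) j| = t * ∑ j, |Δ j| := by
      simp [abs_mul, abs_of_nonneg ht, Finset.mul_sum]
    have hta : |t * a| = t * |a| := by rw [abs_mul, abs_of_nonneg ht]
    rw [← hsum, ← hta]
    refine error_bound_of_small hb hr hH hs hs0 (fun i => ?_) ?_
    · refine (abs_add_le _ _).trans ?_
      have := abs_dotProduct_le (t • Δ) _ (hx i)
      rw [hsum] at this
      rw [hta]
      refine le_trans ?_ htN
      simp only [N]
      linarith
    · have h1 := penalizedLoss_convex (by positivity : 0 ≤ 2 * r) x0 x1 δ a β Δ ht ht1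
      rw [hδ, hβ] at h1
      have h2 := mul_le_mul_of_nonneg_left (hest δ β) ht
      linarith
  -- If `N > 1 / 5`, rescaling the increment to size exactly `1 / 5` makes the local bound
  -- applicable, yet with `hsmall` that bound gives size at most `1 / 10`.
  have hN5 : N ≤ 1 / 5 := by
    by_contra! hlt
    have hpos : 0 < N := by linarith
    have ht1 : 1 / 5 / N ≤ 1 := (div_le_one hpos).mpr hlt.le
    have htN : 1 / 5 / N * N = 1 / 5 := by field_simp
    obtain ⟨h1, h2⟩ := key (1 / 5 / N) (by positivity) ht1 htN.le
    have h3 := mul_le_mul_of_nonneg_left h2 hL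
    have h4 : 1 / 5 / N * N = 1 / 5 / N * |a| + L * (1 / 5 / N * ∑ j, |Δ j|) := by
      simp only [N]; ring
    linarith
  have h := key 1 zero_le_one le_rfl (by linarith)
  rw [one_mul, one_mul] at h
  exact h

/-! ### Measurability, boundedness and integrals under the two laws -/

lemma measurable_linearPredictor {M : ℕ} (δ : ℝ) (β : Fin M → ℝ) :
    Measurable fun x : Fin M → ℝ => δ + β ⬝ᵥ x := by
  unfold dotProduct
  fun_prop

lemma measurable_p0 {M : ℕ} (δ : ℝ) (β : Fin M → ℝ) : Measurable (p0 δ β) := by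
  have := measurable_linearPredictor δ β
  unfold p0
  fun_prop

lemma measurable_p1 {M : ℕ} (δ : ℝ) (β : Fin M → ℝ) : Measurable (p1 δ β) := by
  have := measurable_linearPredictor δ β
  unfold p1
  fun_prop

lemma measurable_residual {M n : ℕ} (δ : ℝ) (β : Fin M → ℝ) (i : Fin n ⊕ Fin n) :
    Measurable (residual δ β i) := by
  cases i with
  | inl i => exact measurable_p1 δ β
  | inr i => exact (measurable_p0 δ β).neg

lemma measurable_withIntercept {M : ℕ} (k : Fin (M + 1)) :
    Measurable fun x : Fin M → ℝ => withIntercept x k := by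
  unfold withIntercept
  refine Fin.cases ?_ (fun j => ?_) k
  · simp
  · simpa using measurable_pi_apply j

lemma abs_residual_le_one {M n : ℕ} (δ : ℝ) (β : Fin M → ℝ) (i : Fin n ⊕ Fin n) (x : Fin M → ℝ) :
    |residual δ β i x| ≤ 1 := by
  have h0 := p0_nonneg δ β x
  have h1 := p1_nonneg δ β x
  have h := p0_add_p1 δ β x
  cases i <;>
  · simp only [residual, Sum.elim_inl, Sum.elim_inr]
    rw [abs_le]
    constructor <;> linarith

lemma abs_withIntercept_le {M : ℕ} {x : Fin M → ℝ} {L : ℝ} (hx : ∀ j, |x j| ≤ L)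
    (k : Fin (M + 1)) : |withIntercept x k| ≤ max 1 L := by
  unfold withIntercept
  refine Fin.cases ?_ (fun j => ?_) k
  · simp
  · simpa using Or.inr (hx j)

lemma integral_controlLaw {M : ℕ} {ν : Measure (Fin M → ℝ)} {δ : ℝ} {β : Fin M → ℝ}
    {q : (Fin M → ℝ) → ℝ} (hq : IsAdmissible ν δ β q) (f : (Fin M → ℝ) → ℝ) :
    ∫ x, f x ∂(controlLaw ν δ β q) = ∫ x, 2 * p0 δ β x * q x * f x ∂ν := by
  have hm := hq.measurable
  have hp := measurable_p0 δ β
  rw [controlLaw, integral_withDensity_eq_integral_toReal_smul (by fun_prop) (by simp)]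
  refine integral_congr_ae (ae_of_all _ fun x => ?_)
  have := p0_nonneg δ β x
  have := hq.nonneg x
  simp only [smul_eq_mul]
  rw [ENNReal.toReal_ofReal (by positivity)]

lemma integral_caseLaw {M : ℕ} {ν : Measure (Fin M → ℝ)} {δ : ℝ} {β : Fin M → ℝ}
    {q : (Fin M → ℝ) → ℝ} (hq : IsAdmissible ν δ β q) (f : (Fin M → ℝ) → ℝ) :
    ∫ x, f x ∂(caseLaw ν δ β q) = ∫ x, 2 * p1 δ β x * q x * f x ∂ν := by
  have hm := hq.measurable
  have hp := measurable_p1 δ β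
  rw [caseLaw, integral_withDensity_eq_integral_toReal_smul (by fun_prop) (by simp)]
  refine integral_congr_ae (ae_of_all _ fun x => ?_)
  have := p1_nonneg δ β x
  have := hq.nonneg x
  simp only [smul_eq_mul]
  rw [ENNReal.toReal_ofReal (by positivity)]

/-! ### Concentration of the score -/

/-- The contribution of one observation to a component of the score, as a random variable. -/
noncomputable def scoreTerm {M n : ℕ} {Ω : Type*} (δ : ℝ) (β : Fin M → ℝ)
    (X0 X1 : Fin n → Ω → (Fin M → ℝ))
    (k : Fin (M + 1)) (i : Fin n ⊕ Fin n) (ω : Ω) : ℝ :=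
  residual δ β i (Sum.elim X0 X1 i ω) * withIntercept (Sum.elim X0 X1 i ω) k

lemma score_eq_sum_scoreTerm {M n : ℕ} {Ω : Type*} {δ : ℝ} {β : Fin M → ℝ}
    {X0 X1 : Fin n → Ω → (Fin M → ℝ)} (k : Fin (M + 1)) (ω : Ω) :
    score δ β (fun i => X0 i ω) (fun i => X1 i ω) k
      = 1 / (2 * (n : ℝ)) * ∑ i, scoreTerm δ β X0 X1 k i ω := by
  simp only [score, scoreTerm, Fintype.sum_sum_type, Sum.elim_inl, Sum.elim_inr]

section Score

variable {M n : ℕ} {Ω : Type*} [MeasurableSpace Ω] {P : Measure Ω} {ν : Measure (Fin M → ℝ)}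
  {δ : ℝ} {β : Fin M → ℝ} {q : (Fin M → ℝ) → ℝ} {X0 X1 : Fin n → Ω → (Fin M → ℝ)}

lemma measurable_scoreWeight (k : Fin (M + 1)) (i : Fin n ⊕ Fin n) :
    Measurable fun x => residual δ β i x * withIntercept x k :=
  (measurable_residual δ β i).mul (measurable_withIntercept k)

namespace IsRetrospectiveSample

lemma measurable (h : IsRetrospectiveSample P ν δ β q X0 X1) (i : Fin n ⊕ Fin n) :
    Measurable (Sum.elim X0 X1 i) := by
  cases i with
  | inl i => exact h.measurable_control i
  | inr i => exact h.measurable_case i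

/-- Individual terms are not centred: controls have mean `m` and cases `-m`, the same integral of `2
* p0 * p1 * q` up to sign. Cancellation uses the equal numbers of cases and controls. -/
lemma sum_integral_scoreTerm (hq : IsAdmissible ν δ β q)
    (h : IsRetrospectiveSample P ν δ β q X0 X1) (k : Fin (M + 1)) :
    ∑ i, ∫ ω, scoreTerm δ β X0 X1 k i ω ∂P = 0 := by
  set m := ∫ x, 2 * p0 δ β x * q x * (p1 δ β x * withIntercept x k) ∂ν with hm
  have h0 : ∀ i, ∫ ω, scoreTerm δ β X0 X1 k (Sum.inl i) ω ∂P = m := fun i => by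
    rw [hm, ← integral_controlLaw hq fun x => p1 δ β x * withIntercept x k, ← h.law_control i,
      integral_map (h.measurable_control i).aemeasurable]
    · rfl
    · exact ((measurable_p1 δ β).mul (measurable_withIntercept k)).aestronglyMeasurable
  have h1 : ∀ i, ∫ ω, scoreTerm δ β X0 X1 k (Sum.inr i) ω ∂P = -m := fun i => by
    have : -m = ∫ x, 2 * p1 δ β x * q x * (-p0 δ β x * withIntercept x k) ∂ν := by
      rw [hm, ← integral_neg]
      exact integral_congr_ae (ae_of_all _ fun x => by ring)
    rw [this, ← integral_caseLaw hq fun x => -p0 δ β x * withIntercept x k, ← h.law_case i,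
      integral_map (h.measurable_case i).aemeasurable]
    · rfl
    · exact ((measurable_p0 δ β).neg.mul (measurable_withIntercept k)).aestronglyMeasurable
  simp [Fintype.sum_sum_type, h0, h1]

lemma hasSubgaussianMGF_scoreTerm [IsProbabilityMeasure P]
    (h : IsRetrospectiveSample P ν δ β q X0 X1) {L : ℝ}
    (hb : ∀ i, ∀ᵐ ω ∂P, ∀ j, |Sum.elim X0 X1 i ω j| ≤ L) (k : Fin (M + 1)) (i : Fin n ⊕ Fin n) :
    HasSubgaussianMGF (fun ω => scoreTerm δ β X0 X1 k i ω - ∫ ω', scoreTerm δ β X0 X1 k i ω' ∂P)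
      (Real.toNNReal (max 1 L) ^ 2) P := by
  have hK : 0 ≤ max 1 L := le_max_of_le_left zero_le_one
  have := hasSubgaussianMGF_of_mem_Icc (μ := P) (X := scoreTerm δ β X0 X1 k i)
    (a := -max 1 L) (b := max 1 L)
    ((measurable_scoreWeight k i).comp (h.measurable i)).aemeasurable (by
      filter_upwards [hb i] with ω hω
      rw [Set.mem_Icc, ← abs_le, scoreTerm, abs_mul]
      exact (mul_le_mul (abs_residual_le_one δ β i _) (abs_withIntercept_le hω k)
        (abs_nonneg _) zero_le_one).trans_eq (one_mul _))
  convert this using 2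
  ext
  rw [Real.coe_toNNReal _ hK, NNReal.coe_div, coe_nnnorm, sub_neg_eq_add, Real.norm_eq_abs,
    abs_of_nonneg (by positivity)]
  simp

lemma iIndepFun_scoreTerm (h : IsRetrospectiveSample P ν δ β q X0 X1) (k : Fin (M + 1)) :
    iIndepFun (fun i ω => scoreTerm δ β X0 X1 k i ω - ∫ ω', scoreTerm δ β X0 X1 k i ω' ∂P) P :=
  h.indep.comp (fun i x => residual δ β i x * withIntercept x k
    - ∫ ω', scoreTerm δ β X0 X1 k i ω' ∂P)
    fun i => (measurable_scoreWeight k i).sub_const _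

/-- Hoeffding's inequality for a component of the score. -/
lemma measure_abs_score_ge_le [IsProbabilityMeasure P] (hn : 0 < n) (hq : IsAdmissible ν δ β q)
    (h : IsRetrospectiveSample P ν δ β q X0 X1) {L : ℝ}
    (hb : ∀ i, ∀ᵐ ω ∂P, ∀ j, |Sum.elim X0 X1 i ω j| ≤ L) (k : Fin (M + 1)) {t : ℝ} (ht : 0 ≤ t) :
    P.real {ω | t ≤ |score δ β (fun i => X0 i ω) (fun i => X1 i ω) k|}
      ≤ 2 * Real.exp (-(n * t ^ 2 / max 1 L ^ 2)) := by
  have hn' : (0 : ℝ) < n := Nat.cast_pos.mpr hn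
  have hK : 0 < max 1 L := lt_max_of_lt_left zero_lt_one
  have hsum : ∀ ω, ∑ i, (scoreTerm δ β X0 X1 k i ω - ∫ ω', scoreTerm δ β X0 X1 k i ω' ∂P)
      = 2 * n * score δ β (fun i => X0 i ω) (fun i => X1 i ω) k := fun ω => by
    rw [Finset.sum_sub_distrib, sum_integral_scoreTerm hq h, score_eq_sum_scoreTerm]
    field_simp
    ring
  have hind := h.iIndepFun_scoreTerm k
  -- There are `2 * n` terms, each with values in an interval of half-length `max 1 L`; the `1`
  -- accounts for the intercept.
  have hexp : -(2 * n * t) ^ 2 / (2 *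
      ((∑ _i : Fin n ⊕ Fin n, Real.toNNReal (max 1 L) ^ 2 : NNReal) : ℝ))
      = -(n * t ^ 2 / max 1 L ^ 2) := by
    simp only [Finset.sum_const, Finset.card_univ, Fintype.card_sum, Fintype.card_fin,
      nsmul_eq_mul]
    push_cast
    rw [Real.coe_toNNReal _ hK.le]
    field_simp
    ring
  have hup := HasSubgaussianMGF.measure_sum_ge_le_of_iIndepFun hind (s := Finset.univ)
    (fun i _ => h.hasSubgaussianMGF_scoreTerm hb k i) (ε := 2 * n * t) (by positivity)
  have hlow := HasSubgaussianMGF.measure_sum_ge_le_of_iIndepFun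
    (hind.comp (fun _ x => -x) fun _ => measurable_neg) (s := Finset.univ)
    (fun i _ => (h.hasSubgaussianMGF_scoreTerm hb k i).neg) (ε := 2 * n * t) (by positivity)
  simp only [Function.comp_apply, Finset.sum_neg_distrib, hsum] at hup hlow
  rw [hexp] at hup hlow
  calc P.real {ω | t ≤ |score δ β (fun i => X0 i ω) (fun i => X1 i ω) k|}
      ≤ P.real ({ω | 2 * n * t ≤ 2 * n * score δ β (fun i => X0 i ω) (fun i => X1 i ω) k}
        ∪ {ω | 2 * n * t ≤ -(2 * n * score δ β (fun i => X0 i ω) (fun i => X1 i ω) k)}) := by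
        refine measureReal_mono fun ω hω => ?_
        rw [Set.mem_ofPred_eq] at hω
        rcases le_abs.mp hω with h' | h'
        · exact Or.inl (mul_le_mul_of_nonneg_left h' (by positivity))
        · refine Or.inr ((mul_le_mul_of_nonneg_left h' (by positivity :
            (0 : ℝ) ≤ 2 * n)).trans_eq (by ring))
    _ ≤ _ := (measureReal_union_le _ _).trans (by linarith)

end IsRetrospectiveSample

end Score

/-! ### The tuning sequence and the union bound -/

lemma tuning_ge {L : ℝ} (hL : 0 ≤ L) (M n : ℕ) (d : ℝ) :
    Real.log n * (6 * L * √(2 * Real.log (2 * ((max M n : ℕ) : ℝ)) / n)) ≤ tuning L M n d := by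
  unfold tuning
  refine mul_le_mul_of_nonneg_left ?_ (Real.log_natCast_nonneg n)
  have h1 : 0 ≤ 1 / (4 * ((max M n : ℕ) : ℝ)) := by positivity
  -- This holds even when `d > 1`, since `√` vanishes at negative arguments.
  have h2 : 0 ≤ 4 * L * √(2 * Real.log (1 / d) / n) := by positivity
  linarith

lemma tuning_pos {L : ℝ} (hL : 0 < L) (M : ℕ) {n : ℕ} (hn : 2 ≤ n) (d : ℝ) :
    0 < tuning L M n d := by
  refine lt_of_lt_of_le ?_ (tuning_ge hL.le M n d)
  have hn1 : (1 : ℝ) < n := by exact_mod_cast hn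
  have hmax : (n : ℝ) ≤ ((max M n : ℕ) : ℝ) := by exact_mod_cast le_max_right M n
  have h1 := Real.log_pos hn1
  have h2 := Real.log_pos (x := 2 * ((max M n : ℕ) : ℝ)) (by linarith)
  positivity

/-- A union bound: with probability at least `1 - 1/n` the score is at most `r / 10` in the
supremum norm. -/
lemma IsRetrospectiveSample.measure_exists_score_ge_le {M n : ℕ} {Ω : Type*} [MeasurableSpace Ω]
    {P : Measure Ω} [IsProbabilityMeasure P] {ν : Measure (Fin M → ℝ)}
    {δ : ℝ} {β : Fin M → ℝ} {q : (Fin M → ℝ) → ℝ} {X0 X1 : Fin n → Ω → (Fin M → ℝ)}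
    (hn : 0 < n) (hq : IsAdmissible ν δ β q) (h : IsRetrospectiveSample P ν δ β q X0 X1) {L d : ℝ}
    (hL : 0 < L) (hb : ∀ i, ∀ᵐ ω ∂P, ∀ j, |Sum.elim X0 X1 i ω j| ≤ L)
    (hlog : 2 * max 1 L ≤ L * Real.log n) :
    P {ω | ∃ k, tuning L M n d / 10 ≤ |score δ β (fun i => X0 i ω) (fun i => X1 i ω) k|}
      ≤ ENNReal.ofReal (1 / n) := by
  have hn' : (0 : ℝ) < n := Nat.cast_pos.mpr hn
  have hK : 0 < max 1 L := lt_max_of_lt_left zero_lt_one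
  set r := tuning L M n d
  set m := max M n with hm
  have hm1 : 1 ≤ m := le_trans hn (le_max_right _ _)
  have hm1' : (1 : ℝ) ≤ m := by exact_mod_cast hm1
  set l := Real.log (2 * (m : ℝ)) with hl
  have hl0 : 0 ≤ l := Real.log_nonneg (by linarith)
  have hr := tuning_ge hL.le M n d
  have hr0 : 0 ≤ r := le_trans (mul_nonneg (Real.log_natCast_nonneg n) (by positivity)) hr
  -- The factor `log n` in `r` absorbs `max 1 L / L` and the division by `10`: `36 * 2 ^ 2 * 2 / 100
  -- = 72 / 25 ≥ 2`. Each tail is then at most `2 / (2 * m) ^ 2`, and `M + 1 ≤ 2 * m` coordinates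
  -- cost `1 / m` in total.
  have hexp : 2 * l ≤ n * (r / 10) ^ 2 / max 1 L ^ 2 := by
    rw [le_div_iff₀ (by positivity)]
    have h1 : (Real.log n * (6 * L * √(2 * l / n))) ^ 2 ≤ r ^ 2 :=
      pow_le_pow_left₀ (mul_nonneg (Real.log_natCast_nonneg n) (by positivity)) hr 2
    have h2 : (Real.log n * (6 * L * √(2 * l / n))) ^ 2
        = 36 * (L * Real.log n) ^ 2 * (2 * l / n) := by
      rw [mul_pow, mul_pow, Real.sq_sqrt (by positivity : 0 ≤ 2 * l / n)]
      ring
    have h3 : (2 * max 1 L) ^ 2 ≤ (L * Real.log n) ^ 2 := pow_le_pow_left₀ (by positivity) hlog 2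
    calc 2 * l * max 1 L ^ 2 ≤ n * (36 * (2 * max 1 L) ^ 2 * (2 * l / n)) / 100 := by
          have : n * (36 * (2 * max 1 L) ^ 2 * (2 * l / n)) / 100
              = 72 / 25 * (l * max 1 L ^ 2) := by field_simp; ring
          rw [this]
          have : 0 ≤ l * max 1 L ^ 2 := by positivity
          linarith
      _ ≤ n * (36 * (L * Real.log n) ^ 2 * (2 * l / n)) / 100 := by gcongr
      _ ≤ n * r ^ 2 / 100 := by
          rw [← h2]
          gcongr
      _ = n * (r / 10) ^ 2 := by ring
  have hk : ∀ k, P {ω | r / 10 ≤ |score δ β (fun i => X0 i ω) (fun i => X1 i ω) k|}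
      ≤ ENNReal.ofReal (2 / (2 * (m : ℝ)) ^ 2) := fun k => by
    rw [← ofReal_measureReal]
    refine ENNReal.ofReal_le_ofReal
      ((h.measure_abs_score_ge_le hn hq hb k (t := r / 10) (by positivity)).trans ?_)
    have : Real.exp (-(2 * l)) = 1 / (2 * (m : ℝ)) ^ 2 := by
      rw [Real.exp_neg, two_mul, Real.exp_add, hl, Real.exp_log (by positivity), one_div, sq]
    calc 2 * Real.exp (-(n * (r / 10) ^ 2 / max 1 L ^ 2)) ≤ 2 * Real.exp (-(2 * l)) := by gcongr
      _ = _ := by rw [this]; ring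
  have hset : {ω | ∃ k, r / 10 ≤ |score δ β (fun i => X0 i ω) (fun i => X1 i ω) k|}
      = ⋃ k, {ω | r / 10 ≤ |score δ β (fun i => X0 i ω) (fun i => X1 i ω) k|} := by
    ext ω; simp
  rw [hset]
  refine (measure_iUnion_fintype_le P _).trans ((Finset.sum_le_sum fun k _ => hk k).trans ?_)
  rw [Finset.sum_const, Finset.card_univ, Fintype.card_fin, nsmul_eq_mul,
    ← ENNReal.ofReal_natCast, ← ENNReal.ofReal_mul (Nat.cast_nonneg _)]
  refine ENNReal.ofReal_le_ofReal ?_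
  have hM : ((M + 1 : ℕ) : ℝ) ≤ 2 * m := by
    have := le_max_left M n
    exact_mod_cast (by omega : M + 1 ≤ 2 * m)
  have hnm : (n : ℝ) ≤ m := by exact_mod_cast le_max_right M n
  calc ((M + 1 : ℕ) : ℝ) * (2 / (2 * (m : ℝ)) ^ 2)
      ≤ 2 * (m : ℝ) * (2 / (2 * (m : ℝ)) ^ 2) := by gcongr
    _ = 1 / (m : ℝ) := by field_simp
    _ ≤ 1 / (n : ℝ) := by gcongr

/-! ### From the deterministic bound to probabilities -/

/-- Without active covariates the intercept component of the score vanishes. -/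
lemma IsAdmissible.score_zero_eq_zero {M n : ℕ} {ν : Measure (Fin M → ℝ)} {δ : ℝ}
    {β : Fin M → ℝ} {q : (Fin M → ℝ) → ℝ} (hq : IsAdmissible ν δ β q)
    (hβ : (activeSet β).card = 0) (x0 x1 : Fin n → Fin M → ℝ) : score δ β x0 x1 0 = 0 := by
  have hβ0 : β = 0 := by
    funext j
    by_contra hj
    have : j ∈ activeSet β := by simpa [activeSet] using hj
    rw [Finset.card_eq_zero] at hβ
    simp [hβ] at this
  subst hβ0
  have hconst : ∀ x, p0 δ (0 : Fin M → ℝ) x = p0 δ (0 : Fin M → ℝ) 0 := fun x => by simp [p0]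
  -- With `β = 0` the probability is constant in `x`, and the normalization of `f₀` fixes it at `1 /
  -- 2`.
  have hhalf : ∀ x, p0 δ (0 : Fin M → ℝ) x = 1 / 2 := fun x => by
    have := hq.constraint_zero
    simp_rw [hconst] at this
    rw [integral_const_mul, hq.integral_eq_one, mul_one] at this
    rw [hconst, this]
  have hhalf1 : ∀ x, p1 δ (0 : Fin M → ℝ) x = 1 / 2 := fun x => by
    have := p0_add_p1 δ (0 : Fin M → ℝ) x
    rw [hhalf] at this
    linarith
  simp [score, residual, withIntercept, Fintype.sum_sum_type, hhalf, hhalf1]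

/-- For large samples both error bounds hold off an event of probability `1 / n`, on the event that
the sample Hessian is bounded below. -/
lemma IsRetrospectiveSample.ae_error_bound {M n : ℕ} {Ω : Type*} [MeasurableSpace Ω]
    {P : Measure Ω} {ν : Measure (Fin M → ℝ)}
    {δ : ℝ} {β : Fin M → ℝ} {q : (Fin M → ℝ) → ℝ} {X0 X1 : Fin n → Ω → (Fin M → ℝ)}
    (hn : 2 ≤ n) (hq : IsAdmissible ν δ β q) {L d b : ℝ} (hL : 0 < L) (hb : 0 < b)
    (hX : ∀ i, ∀ᵐ ω ∂P, ∀ j, |Sum.elim X0 X1 i ω j| ≤ L)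
    {δh : Ω → ℝ} {βh : Ω → Fin M → ℝ}
    (hest : ∀ᵐ ω ∂P, IsPenalizedEstimate (2 * tuning L M n d) (fun i => X0 i ω)
      (fun i => X1 i ω) (δh ω) (βh ω))
    (hsmall : (1 + L) * (6 / b * tuning L M n d * (activeSet β).card) ≤ 1 / 10) :
    ∀ᵐ ω ∂P, (sampleHessian δ β (fun i => X0 i ω) (fun i => X1 i ω)
        - b • selector β).PosSemidef →
      (∃ k, tuning L M n d / 10 ≤ |score δ β (fun i => X0 i ω) (fun i => X1 i ω) k|) ∨
      (|δh ω - δ| ≤ 6 / b * tuning L M n d * (activeSet β).card ∧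
        ∑ j, |βh ω j - β j| ≤ 6 / b * tuning L M n d * (activeSet β).card) := by
  have hr := tuning_pos hL M hn d
  filter_upwards [ae_all_iff.mpr hX, hest] with ω hω hestω hHω
  refine or_iff_not_imp_left.mpr fun hs => ?_
  push Not at hs
  refine hestω.error_bound hb hr hL.le (fun i => hω (Sum.inl i)) (fun i => hω (Sum.inr i)) hHω
    (fun j => (hs _).le) ?_ hsmall
  -- For `k* = 0` the claimed error is zero, so a score of order `r` is not good enough for the
  -- unpenalized intercept; it must vanish exactly.
  rcases Nat.eq_zero_or_pos (activeSet β).card with hk | hk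
  · simp [hq.score_zero_eq_zero hk, hk]
  · have h1 : (1 : ℝ) ≤ (activeSet β).card := by exact_mod_cast hk
    have h2 := pow_le_pow_left₀ (abs_nonneg _) (hs 0).le 2
    rw [sq_abs] at h2
    calc score δ β (fun i => X0 i ω) (fun i => X1 i ω) 0 ^ 2
        ≤ tuning L M n d ^ 2 / 100 * 1 := h2.trans_eq (by ring)
      _ ≤ _ := by gcongr

/-- A sequence of events containing, up to events of vanishing probability, a sequence of events
whose probabilities tend to one. -/
lemma tendsto_measure_one_of_le_add {Ω : ℕ → Type*} [∀ n, MeasurableSpace (Ω n)]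
    (P : ∀ n, Measure (Ω n)) [∀ n, IsProbabilityMeasure (P n)] {A T : ∀ n, Set (Ω n)}
    {ε : ℕ → ENNReal} (hA : Tendsto (fun n => P n (A n)) atTop (𝓝 1))
    (hε : Tendsto ε atTop (𝓝 0)) (h : ∀ᶠ n in atTop, P n (A n) ≤ P n (T n) + ε n) :
    Tendsto (fun n => P n (T n)) atTop (𝓝 1) := by
  have hlim : Tendsto (fun n => P n (A n) - ε n) atTop (𝓝 1) := by
    simpa using ENNReal.Tendsto.sub hA hε (Or.inl ENNReal.one_ne_top)
  refine tendsto_of_tendsto_of_tendsto_of_le_of_le' hlim tendsto_const_nhds ?_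
    (Eventually.of_forall fun n => prob_le_one)
  filter_upwards [h] with n hn
  exact tsub_le_iff_right.mpr hn

end CaseControl

theorem mainTheorem4
    {Ω : ℕ → Type*} [∀ n, MeasurableSpace (Ω n)]
    (P : ∀ n, Measure (Ω n)) [∀ n, IsProbabilityMeasure (P n)]
    -- the model for sample size `n`
    (M : ℕ → ℕ)
    (ν : ∀ n, Measure (Fin (M n) → ℝ))
    (q : ∀ n, (Fin (M n) → ℝ) → ℝ)
    (δstar : ℕ → ℝ) (βstar : ∀ n, Fin (M n) → ℝ)
    (hmodel : ∀ n, CaseControl.IsAdmissible (ν n) (δstar n) (βstar n) (q n))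
    -- the two samples
    (X0 X1 : ∀ n, Fin n → Ω n → (Fin (M n) → ℝ))
    (hsample : ∀ n, CaseControl.IsRetrospectiveSample (P n) (ν n) (δstar n) (βstar n) (q n)
      (X0 n) (X1 n))
    -- bounded design and bounded true parameters
    (L B : ℝ) (hL : 0 < L) (hB : 0 < B)
    (hX0 : ∀ n i, ∀ᵐ ω ∂(P n), ∀ j, |X0 n i ω j| ≤ L)
    (hX1 : ∀ n i, ∀ᵐ ω ∂(P n), ∀ j, |X1 n i ω j| ≤ L)
    (hβ : ∀ n j, |βstar n j| ≤ B) (hδ : ∀ n, |δstar n| ≤ B)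
    -- the tuning sequence
    (d : ℕ → ℝ) (hd_pos : ∀ n, 0 < d n) (hd : Tendsto d atTop (𝓝 0))
    (r : ℕ → ℝ) (hr : ∀ n, r n = CaseControl.tuning L (M n) n (d n))
    (hkr : Tendsto (fun n => ((CaseControl.activeSet (βstar n)).card : ℝ) * r n) atTop (𝓝 0))
    -- the condition on the sample Hessian
    (b : ℝ) (hb : 0 < b) (hb1 : b ≤ 1)
    (hH : Tendsto (fun n => P n {ω |
        (CaseControl.sampleHessian (δstar n) (βstar n) (fun i => X0 n i ω) (fun i => X1 n i ω)
          - b • CaseControl.selector (βstar n)).PosSemidef}) atTop (𝓝 1))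
    -- the estimators, with tuning parameter `2r`
    (δhat : ∀ n, Ω n → ℝ) (βhat : ∀ n, Ω n → (Fin (M n) → ℝ))
    (hhat : ∀ᶠ n in atTop, ∀ᵐ ω ∂(P n),
      CaseControl.IsPenalizedEstimate (2 * r n) (fun i => X0 n i ω) (fun i => X1 n i ω)
        (δhat n ω) (βhat n ω))
    (w : ℝ) (hw : 0 < w) (hw1 : w < 1) :
    Tendsto (fun n => P n {ω | |δhat n ω - δstar n|
        ≤ 6 / (b * w) * r n * ((CaseControl.activeSet (βstar n)).card : ℝ)}) atTop (𝓝 1)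
    ∧ Tendsto (fun n => P n {ω | ∑ j, |βhat n ω j - βstar n j|
        ≤ 6 / (b * w) * r n * ((CaseControl.activeSet (βstar n)).card : ℝ)}) atTop (𝓝 1) := by
  set k : ℕ → ℝ := fun n => ((CaseControl.activeSet (βstar n)).card : ℝ)
  have hX : ∀ n i, ∀ᵐ ω ∂(P n), ∀ j, |Sum.elim (X0 n) (X1 n) i ω j| ≤ L := by
    rintro n (i | i)
    exacts [hX0 n i, hX1 n i]
  have hlog : ∀ᶠ n : ℕ in atTop, 2 * max 1 L ≤ L * Real.log n :=
    ((Real.tendsto_log_atTop.comp tendsto_natCast_atTop_atTop).const_mul_atTop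
      hL).eventually_ge_atTop _
  have hsmall : ∀ᶠ n in atTop, (1 + L) * (6 / b * r n * k n) ≤ 1 / 10 := by
    have := hkr.const_mul ((1 + L) * (6 / b))
    rw [mul_zero] at this
    filter_upwards [this.eventually_le_const (by norm_num : (0 : ℝ) < 1 / 10)] with n hn
    calc (1 + L) * (6 / b * r n * k n) = (1 + L) * (6 / b) * (k n * r n) := by ring
      _ ≤ _ := hn
  have hε : Tendsto (fun n : ℕ => ENNReal.ofReal (1 / n)) atTop (𝓝 0) := by
    simpa using ENNReal.tendsto_ofReal tendsto_one_div_atTop_nhds_zero_nat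
  have hmain : ∀ᶠ n in atTop, P n {ω | (CaseControl.sampleHessian (δstar n) (βstar n)
        (fun i => X0 n i ω) (fun i => X1 n i ω)
          - b • CaseControl.selector (βstar n)).PosSemidef}
      ≤ P n {ω | |δhat n ω - δstar n| ≤ 6 / (b * w) * r n * k n ∧
        ∑ j, |βhat n ω j - βstar n j| ≤ 6 / (b * w) * r n * k n} + ENNReal.ofReal (1 / n) := by
    filter_upwards [hlog, hsmall, hhat, eventually_ge_atTop 2] with n hlogn hsmalln hhatn hn
    have hpos : 0 < r n := by
      rw [hr]
      exact CaseControl.tuning_pos hL _ hn _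
    -- The deterministic constant `6 / b` is relaxed to `c`.
    have hc : 6 / b * r n * k n ≤ 6 / (b * w) * r n * k n := by
      have hbw : b * w ≤ b := mul_le_of_le_one_right hb.le hw1.le
      gcongr
    rw [hr] at hsmalln hhatn hc
    rw [hr]
    -- Only monotonicity and subadditivity are used, as the estimators are not assumed measurable.
    refine le_trans ?_ ((measure_union_le _ _).trans (add_le_add_right
      ((hsample n).measure_exists_score_ge_le (d := d n) (by omega) (hmodel n) hL (hX n) hlogn)
      _))
    refine measure_mono_ae ?_
    filter_upwards [CaseControl.IsRetrospectiveSample.ae_error_bound hn (hmodel n) hL hb (hX n)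
      hhatn hsmalln] with ω hω hHω
    rcases hω hHω with h | ⟨h1, h2⟩
    · exact Or.inr h
    · exact Or.inl ⟨h1.trans hc, h2.trans hc⟩
  refine ⟨CaseControl.tendsto_measure_one_of_le_add P hH hε ?_,
    CaseControl.tendsto_measure_one_of_le_add P hH hε ?_⟩
  · filter_upwards [hmain] with n hn
    exact hn.trans (add_le_add_left (measure_mono fun ω hω => hω.1) _)
  · filter_upwards [hmain] with n hn
    exact hn.trans (add_le_add_left (measure_mono fun ω hω => hω.2) _)
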